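/- **Proposition 3.5 (maximum principle).** Let $n\ge 2$, $0<s<1$, and let $\Omega\subset\mathbb R^n$ be a bounded domain (nonempty, open, connected) with $C^{1,1}$ boundary; put $\Omega_e:=\mathbb R^n\setminus\overline\Omega$. Let $A\in L^\infty(\mathbb R^n;\mathbb R^n)$ be such that, for some $r>0$, $\Omega\cup\operatorname{supp}A\subset B_r(0)$ and $|A_i|\le \pi/(8\sqrt n\,r)$ a.e. in $\mathbb R^n$ for $i=1,\dots,n$. Let $K(x,y)=c_{n,s}|x-y|^{-n-2s}$, where $c_{n,s}=\dfrac{4^s\,\Gamma(n/2+s)}{2\pi^{n/2}|\Gamma(-s)|}$, and for real-valued $u,v\in H^s(\mathbb R^n)$ let $$\langle\mathcal R^s_Au,v\rangle:=\operatorname{Re}\iint\bigl(u(x)-e^{i\theta(x,y)}u(y)\bigr)\bigl(v(x)-e^{-i\theta(x,y)}v(y)\bigr)K(x,y)\,dx\,dy,\qquad \theta(x,y)=(x-y)\cdot A\bigl(\tfrac{x+y}2\bigr).$$ All function spaces are real; $H^{-s}(\mathbb R^n)$ is the dual of $H^s(\mathbb R^n)$, and $H^{-s}(\Omega)$ is the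 space of restrictions to $\Omega$ of its elements, that is, of distributions on $\Omega$ acting on $C_c^\infty(\Omega)$. Let $q\in L^\infty(\Omega)$ with $q\ge c$ a.e. in $\Omega$ for some constant $c>0$. Let $f\in H^{-s}(\Omega)$ with $f\ge 0$, i.e. $f(\varphi)\ge 0$ for all $0\le\varphi\in C_c^\infty(\Omega)$, and let $g\in L^\infty(\Omega_e)$ with $g\ge 0$ a.e. in $\Omega_e$. If $u\in H^s(\mathbb R^n)$ solves $(\mathcal R^s_A+q)u=f$ in $\Omega$, i.e. $$\langle\mathcal R^s_Au,\varphi\rangle+\int_\Omega q\,u\,\varphi\,dx=f(\varphi)\qquad\text{for all }\varphi\in C_c^\infty(\Omega),$$ and $u=g$ a.e. in $\Omega_e$, then $u\ge 0$ a.e. in $\mathbb R^n$. -/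

import Mathlib

open MeasureTheory Set Metric
open scoped ENNReal NNReal ContDiff InnerProductSpace

noncomputable section

/-- Euclidean space `ℝⁿ`. -/
abbrev Rn (n : ℕ) : Type := EuclideanSpace ℝ (Fin n)

/-- Bounded domains with `C^{1,1}` boundary: bounded, open, nonempty and connected sets which, near
every boundary point, lie on one side of the graph of a `C^{1,1}` function `γ` in a suitable
Cartesian coordinate system. The coordinates are given by a unit vector `ν` (the graph direction)
and its orthogonal complement (the base of the graph). -/
structure IsBoundedC11Domain {n : ℕ} (Ω : Set (Rn n)) : Prop where
  isOpen : IsOpen Ω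
  isConnected : IsConnected Ω
  isBounded : Bornology.IsBounded Ω
  boundary : ∀ p ∈ frontier Ω, ∃ ν : Rn n, ‖ν‖ = 1 ∧
    ∃ γ : (Submodule.span ℝ {ν})ᗮ → ℝ,
      ContDiff ℝ 1 γ ∧ (∃ L : ℝ≥0, LipschitzWith L (fderiv ℝ γ)) ∧
      ∃ ρ > 0, ∀ x ∈ ball p ρ,
        x ∈ Ω ↔ γ ((Submodule.span ℝ {ν})ᗮ.orthogonalProjectionOnto x) < ⟪ν, x⟫_ℝ

/-- The exterior `Ω_e = ℝⁿ \ closure Ω`. -/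
def exteriorSet {n : ℕ} (Ω : Set (Rn n)) : Set (Rn n) := (closure Ω)ᶜ

/-- The support of an almost everywhere defined vector field: the complement of the largest open
set on which it vanishes almost everywhere. -/
def essSupport {n : ℕ} (A : Rn n → Rn n) : Set (Rn n) :=
  {x | ∀ U : Set (Rn n), IsOpen U → x ∈ U → ¬ ∀ᵐ y ∂(volume.restrict U), A y = 0}

/-- The difference quotient `(u(x) - u(y)) / |x - y|^{(n+2s)/2}` of the Gagliardo seminorm. -/
def gagliardoQuotient {n : ℕ} (s : ℝ) (u : Rn n → ℝ) (p : Rn n × Rn n) : ℝ :=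
  (u p.1 - u p.2) / ‖p.1 - p.2‖ ^ (((n : ℝ) + 2 * s) / 2)

/-- The real Sobolev space `H^s(ℝⁿ)`, `0 < s < 1`, as a space of functions (not identified when
they agree almost everywhere): `u ∈ L²(ℝⁿ)` with finite Gagliardo seminorm. -/
def sobolevSpace (n : ℕ) (s : ℝ) : Submodule ℝ (Rn n → ℝ) where
  carrier := {u | MemLp u 2 volume ∧ MemLp (gagliardoQuotient s u) 2 volume}
  zero_mem' := by
    refine ⟨MemLp.zero, ?_⟩
    have h : gagliardoQuotient s (0 : Rn n → ℝ) = 0 := by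
      funext p; simp [gagliardoQuotient]
    rw [h]; exact MemLp.zero
  add_mem' := by
    intro u v hu hv
    refine ⟨hu.1.add hv.1, ?_⟩
    have h : gagliardoQuotient s (u + v) = gagliardoQuotient s u + gagliardoQuotient s v := by
      funext p; simp only [gagliardoQuotient, Pi.add_apply]; ring
    rw [h]; exact hu.2.add hv.2
  smul_mem' := by
    intro a u hu
    refine ⟨hu.1.const_smul a, ?_⟩
    have h : gagliardoQuotient s (a • u) = a • gagliardoQuotient s u := by
      funext p; simp only [gagliardoQuotient, Pi.smul_apply, smul_eq_mul]; ring
    rw [h]; exact hu.2.const_smul a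

/-- The norm of `H^s(ℝⁿ)`:
`(‖u‖²_{L²} + ∬ |u(x) - u(y)|² / |x - y|^{n+2s} dx dy)^{1/2}`. -/
def sobolevNorm {n : ℕ} (s : ℝ) (u : Rn n → ℝ) : ℝ :=
  √((∫ x, u x ^ 2) + ∫ p : Rn n × Rn n, gagliardoQuotient s u p ^ 2)

/-- The test functions `C_c^∞(Ω)`, as a subspace of `H^s(ℝⁿ)`; for `0 < s < 1` each of them
belongs to `H^s(ℝⁿ)`. -/
def testSpace (n : ℕ) (s : ℝ) (Ω : Set (Rn n)) : Submodule ℝ (sobolevSpace n s) where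
  carrier := {v | ContDiff ℝ ∞ (v : Rn n → ℝ) ∧ HasCompactSupport (v : Rn n → ℝ) ∧
    tsupport (v : Rn n → ℝ) ⊆ Ω}
  zero_mem' := by
    refine ⟨contDiff_const, HasCompactSupport.zero, ?_⟩
    change tsupport (0 : Rn n → ℝ) ⊆ Ω
    simp
  add_mem' := by
    intro v w hv hw
    exact ⟨hv.1.add hw.1, hv.2.1.add hw.2.1,
      (tsupport_add (v : Rn n → ℝ) (w : Rn n → ℝ)).trans (union_subset hv.2.2 hw.2.2)⟩
  smul_mem' := by
    intro a v hv
    exact ⟨contDiff_const.smul hv.1, hv.2.1.smul_left (f := fun _ => a),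
      (closure_mono (Function.support_const_smul_subset a (v : Rn n → ℝ))).trans hv.2.2⟩

/-- The pointwise values of a test function. -/
def testFun {n : ℕ} {s : ℝ} {Ω : Set (Rn n)} (φ : testSpace n s Ω) : Rn n → ℝ :=
  ((φ : sobolevSpace n s) : Rn n → ℝ)

/-- Membership in `H^{-s}(ℝⁿ) = H^s(ℝⁿ)^*`: linear functionals on `H^s(ℝⁿ)` which are bounded
with respect to the `H^s` norm. -/
def MemHNeg {n : ℕ} {s : ℝ} (F : Module.Dual ℝ (sobolevSpace n s)) : Prop :=
  ∃ C : ℝ, ∀ v : sobolevSpace n s, |F v| ≤ C * sobolevNorm s (v : Rn n → ℝ)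

/-- Membership in `H^{-s}(Ω)`: distributions on `Ω` which are restrictions to `Ω` of elements
of `H^{-s}(ℝⁿ)`. -/
def MemHNegOn {n : ℕ} {s : ℝ} {Ω : Set (Rn n)} (f : Module.Dual ℝ (testSpace n s Ω)) : Prop :=
  ∃ F : Module.Dual ℝ (sobolevSpace n s), MemHNeg F ∧
    ∀ φ : testSpace n s Ω, f φ = F (φ : sobolevSpace n s)

/-- `f ≥ 0` in the sense of distributions on `Ω`. -/
def IsNonnegDistribution {n : ℕ} {s : ℝ} {Ω : Set (Rn n)}
    (f : Module.Dual ℝ (testSpace n s Ω)) : Prop :=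
  ∀ φ : testSpace n s Ω, (∀ x, 0 ≤ testFun φ x) → 0 ≤ f φ

/-- The constant `c_{n,s}`, normalized so that
`2 c_{n,s} lim_{ε → 0} ∫_{|x-y| > ε} (u(x) - u(y)) / |x-y|^{n+2s} dy` is the fractional Laplacian
`(-Δ)^s u(x)`, the Fourier multiplier with symbol `|ξ|^{2s}`. -/
def fracConst (n : ℕ) (s : ℝ) : ℝ :=
  4 ^ s * Real.Gamma ((n : ℝ) / 2 + s) /
    (2 * Real.pi ^ ((n : ℝ) / 2) * |Real.Gamma (-s)|)

/-- The kernel `K(x, y) = c_{n,s} / |x - y|^{n+2s}`. -/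
def fracKernel {n : ℕ} (s : ℝ) (x y : Rn n) : ℝ :=
  fracConst n s / ‖x - y‖ ^ ((n : ℝ) + 2 * s)

/-- The magnetic phase `(x - y) · A((x + y) / 2)`. -/
def magneticPhase {n : ℕ} (A : Rn n → Rn n) (x y : Rn n) : ℝ :=
  ⟪x - y, A ((1 / 2 : ℝ) • (x + y))⟫_ℝ

/-- The bilinear form `⟨𝓡^s_A u, v⟩` on real-valued functions, equal to
`Re ∬ (u(x) - e^{iθ} u(y)) (v(x) - e^{-iθ} v(y)) K(x, y) dx dy` with
`θ = (x - y) · A((x + y) / 2)`. The integral converges absolutely for `u, v ∈ H^s(ℝⁿ)`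
and `A ∈ L^∞(ℝⁿ)`. -/
def magneticForm {n : ℕ} (s : ℝ) (A : Rn n → Rn n) (u v : Rn n → ℝ) : ℝ :=
  (∫ p : Rn n × Rn n,
    ((u p.1 : ℂ) - Complex.exp (Complex.I * (magneticPhase A p.1 p.2 : ℂ)) * (u p.2 : ℂ)) *
    ((v p.1 : ℂ) - Complex.exp (-(Complex.I * (magneticPhase A p.1 p.2 : ℂ))) * (v p.2 : ℂ)) *
    (fracKernel s p.1 p.2 : ℂ)).re

/-- `(𝓡^s_A + q) u = f` in `Ω`, in the sense of distributions on `Ω`. -/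
def SolvesIn {n : ℕ} {s : ℝ} {Ω : Set (Rn n)} (A : Rn n → Rn n) (q : Rn n → ℝ)
    (u : Rn n → ℝ) (f : Module.Dual ℝ (testSpace n s Ω)) : Prop :=
  ∀ φ : testSpace n s Ω,
    magneticForm s A u (testFun φ) + ∫ x in Ω, q x * u x * testFun φ x = f φ

end

/-! The equation is tested with the negative part `w = max (-u) 0`. Up to a positive factor, the
real part of the integrand of the magnetic form at `(x, y)` is `u(x)w(x) + u(y)w(y) - cos θ
(u(x)w(y) + u(y)w(x))`. Since `u w = -w²` and `u ≥ -w`, this is at most `-(w(x) - w(y))²` wherever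
`0 ≤ cos θ`. The smallness of `A` gives that sign whenever `x` or `y` lies in `Ω`: either the
midpoint lies in `B_r`, so that `|x - y| ≤ 4r` and `|θ| ≤ π/2`, or `A` vanishes there. Off these
pairs `w` vanishes at both points. Hence the form is nonpositive (`magneticForm_negPart_nonpos`),
and the potential term is at most `-c ∫ w²`. As `f ≥ 0`, the sum of the two terms is nonnegative,
which forces `w = 0`.

The delicate point is that `w` is not a test function. It belongs to `H^s` and vanishes outside `Ω`,
and `isLimitOfNonnegTests_of_eq_zero_compl` approximates it in `H^s` by nonnegative test functions:
a partition of unity localizes it, a small translation pushes each piece inside `Ω`, and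
mollification makes it smooth; all three operations preserve the sign. Both terms on the left of the
equation are `H^s`-continuous in the test function (`exists_magneticForm_le`,
`exists_potential_le`), so nonnegativity passes to the limit. -/

/-! ### The `H^s` size and its elementary properties. -/

/-- An extended-real valued norm equivalent to the `H^s` norm. -/
noncomputable def hsSize {n : ℕ} (s : ℝ) (w : Rn n → ℝ) : ℝ≥0∞ :=
  eLpNorm w 2 volume + eLpNorm (gagliardoQuotient s w) 2 volume

theorem gagliardoQuotient_congr_ae {n : ℕ} {s : ℝ} {u v : Rn n → ℝ} (h : u =ᵐ[volume] v) :
    gagliardoQuotient s u =ᵐ[volume] gagliardoQuotient s v := by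
  have h1 := (Measure.quasiMeasurePreserving_fst (μ := (volume : Measure (Rn n)))
    (ν := (volume : Measure (Rn n)))).ae_eq_comp h
  have h2 := (Measure.quasiMeasurePreserving_snd (μ := (volume : Measure (Rn n)))
    (ν := (volume : Measure (Rn n)))).ae_eq_comp h
  rw [Measure.volume_eq_prod]
  filter_upwards [h1, h2] with p hp1 hp2
  simp only [Function.comp_apply] at hp1 hp2
  simp only [gagliardoQuotient, hp1, hp2]

theorem aestronglyMeasurable_gagliardoQuotient {n : ℕ} {s : ℝ} {u : Rn n → ℝ}
    (h : AEStronglyMeasurable u volume) :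
    AEStronglyMeasurable (gagliardoQuotient s u) volume := by
  have h1 : AEStronglyMeasurable (fun p : Rn n × Rn n => u p.1) volume :=
    h.comp_quasiMeasurePreserving Measure.quasiMeasurePreserving_fst
  have h2 : AEStronglyMeasurable (fun p : Rn n × Rn n => u p.2) volume :=
    h.comp_quasiMeasurePreserving Measure.quasiMeasurePreserving_snd
  have h3 : Measurable (fun p : Rn n × Rn n => ‖p.1 - p.2‖ ^ (((n : ℝ) + 2 * s) / 2)) := by
    fun_prop
  exact ((h1.sub h2).aemeasurable.div h3.aemeasurable).aestronglyMeasurable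

theorem gagliardoQuotient_add {n : ℕ} {s : ℝ} (u v : Rn n → ℝ) :
    gagliardoQuotient s (u + v) = gagliardoQuotient s u + gagliardoQuotient s v := by
  funext p; simp only [gagliardoQuotient, Pi.add_apply]; ring

theorem hsSize_add_le {n : ℕ} {s : ℝ} {u v : Rn n → ℝ}
    (hu : AEStronglyMeasurable u volume) (hv : AEStronglyMeasurable v volume) :
    hsSize s (u + v) ≤ hsSize s u + hsSize s v := by
  have h1 := eLpNorm_add_le hu hv (p := 2) (by norm_num)
  have h2 := eLpNorm_add_le (aestronglyMeasurable_gagliardoQuotient (s := s) hu)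
    (aestronglyMeasurable_gagliardoQuotient (s := s) hv) (p := 2) (by norm_num)
  rw [hsSize, gagliardoQuotient_add]
  refine (add_le_add h1 h2).trans (le_of_eq ?_)
  simp only [hsSize]; ring

theorem mem_sobolevSpace_iff {n : ℕ} {s : ℝ} {u : Rn n → ℝ} :
    u ∈ sobolevSpace n s ↔ AEStronglyMeasurable u volume ∧ hsSize s u < ⊤ := by
  constructor
  · rintro ⟨h1, h2⟩
    exact ⟨h1.1, ENNReal.add_lt_top.2 ⟨h1.2, h2.2⟩⟩
  · rintro ⟨h1, h2⟩
    have h2 := ENNReal.add_lt_top.1 h2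
    exact ⟨⟨h1, h2.1⟩, ⟨aestronglyMeasurable_gagliardoQuotient h1, h2.2⟩⟩

/-! ### Truncated kernels and multiplication by Lipschitz functions. -/

/-- In polar coordinates the radial density is `min(B, Ly)² y^(-1-2s)`. Near `0` it is bounded by a
multiple of `y^(1-2s)`, integrable because `s < 1`; near infinity by a multiple of `y^(-1-2s)`,
integrable because `0 < s`. -/
theorem integrable_min_sq_div_norm_rpow {n : ℕ} (hn : n ≠ 0) {s : ℝ} (hs0 : 0 < s) (hs1 : s < 1)
    {B L : ℝ} (hB : 0 ≤ B) (hL : 0 ≤ L) :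
    Integrable (fun z : Rn n => (min B (L * ‖z‖) / ‖z‖ ^ (((n : ℝ) + 2 * s) / 2)) ^ 2) := by
  have : Nonempty (Fin n) := Fin.pos_iff_nonempty.1 (Nat.pos_of_ne_zero hn)
  let f : ℝ → ℝ := fun y => (min B (L * y) / y ^ (((n : ℝ) + 2 * s) / 2)) ^ 2
  have hmeas : Measurable f := by fun_prop
  change Integrable (fun z : Rn n => f ‖z‖)
  have key : ∀ y : ℝ, 0 < y → y ^ (n - 1) • f y = (min B (L * y)) ^ 2 * y ^ (-1 - 2 * s) := by
    intro y hy
    have e1 : y ^ (n - 1) = y ^ ((n : ℝ) - 1) := by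
      rw [← Real.rpow_natCast, Nat.cast_sub (Nat.one_le_iff_ne_zero.2 hn)]; simp
    have e2 : (y ^ (((n : ℝ) + 2 * s) / 2)) ^ 2 = y ^ ((n : ℝ) + 2 * s) := by
      rw [← Real.rpow_natCast, ← Real.rpow_mul hy.le]; norm_num
    simp only [f, smul_eq_mul, div_pow, e2, e1]
    rw [show (-1 - 2 * s : ℝ) = ((n : ℝ) - 1) - ((n : ℝ) + 2 * s) by ring,
      Real.rpow_sub hy ((n : ℝ) - 1)]
    generalize y ^ ((n : ℝ) - 1) = a
    generalize y ^ ((n : ℝ) + 2 * s) = b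
    ring
  rw [integrable_fun_norm_addHaar volume, finrank_euclideanSpace, Fintype.card_fin]
  rw [← Ioc_union_Ioi_eq_Ioi (zero_le_one (α := ℝ))]
  have hm : Measurable (fun y : ℝ => y ^ (n - 1) • f y) := by
    simp only [smul_eq_mul]; fun_prop
  refine IntegrableOn.union ?_ ?_
  · have hi : IntegrableOn (fun y : ℝ => L ^ 2 * y ^ (1 - 2 * s)) (Ioc 0 1) :=
      ((intervalIntegrable_iff_integrableOn_Ioc_of_le zero_le_one).1
        (intervalIntegral.intervalIntegrable_rpow' (by linarith))).const_mul _
    refine Integrable.mono' hi hm.aestronglyMeasurable ?_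
    filter_upwards [ae_restrict_mem measurableSet_Ioc] with y hy
    have hy0 := hy.1
    rw [key y hy0, Real.norm_of_nonneg (by positivity)]
    have h1 : (min B (L * y)) ^ 2 ≤ (L * y) ^ 2 :=
      pow_le_pow_left₀ (le_min hB (by positivity)) (min_le_right _ _) 2
    calc _ ≤ (L * y) ^ 2 * y ^ (-1 - 2 * s) := by gcongr
      _ = L ^ 2 * y ^ (1 - 2 * s) := by
        rw [mul_pow, mul_assoc, ← Real.rpow_natCast y 2, ← Real.rpow_add hy0]
        congr 2; push_cast; ring
  · have hi : IntegrableOn (fun y : ℝ => B ^ 2 * y ^ (-1 - 2 * s)) (Ioi 1) :=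
      (integrableOn_Ioi_rpow_of_lt (by linarith) zero_lt_one).const_mul _
    refine Integrable.mono' hi hm.aestronglyMeasurable ?_
    filter_upwards [ae_restrict_mem measurableSet_Ioi] with y hy
    have hy0 : 0 < y := lt_trans zero_lt_one hy
    rw [key y hy0, Real.norm_of_nonneg (by positivity)]
    have h1 : (min B (L * y)) ^ 2 ≤ B ^ 2 :=
      pow_le_pow_left₀ (le_min hB (by positivity)) (min_le_left _ _) 2
    gcongr

/-- By Tonelli and translation invariance, the norm of `k(x - y) v(y)` on the product space is
exactly `‖k‖ ‖v‖`. This controls all the lower-order terms below, where a difference of bounded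
Lipschitz factors is divided by the Gagliardo weight. -/
theorem exists_eLpNorm_kernel_mul_le {n : ℕ} (hn : n ≠ 0) {s : ℝ} (hs0 : 0 < s) (hs1 : s < 1)
    {B L : ℝ} (hB : 0 ≤ B) (hL : 0 ≤ L) :
    ∃ C : ℝ≥0∞, C < ⊤ ∧ ∀ v : Rn n → ℝ, AEStronglyMeasurable v volume →
      eLpNorm (fun p : Rn n × Rn n => min B (L * ‖p.1 - p.2‖) /
        ‖p.1 - p.2‖ ^ (((n : ℝ) + 2 * s) / 2) * v p.2) 2 volume ≤ C * eLpNorm v 2 volume := by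
  set k : Rn n → ℝ := fun z => min B (L * ‖z‖) / ‖z‖ ^ (((n : ℝ) + 2 * s) / 2) with hk
  have hkm : Measurable k := by fun_prop
  have hkL : MemLp k 2 volume :=
    (memLp_two_iff_integrable_sq hkm.aestronglyMeasurable).2
      (integrable_min_sq_div_norm_rpow hn hs0 hs1 hB hL)
  refine ⟨eLpNorm k 2 volume, hkL.2, fun v hv => le_of_eq ?_⟩
  simp only [eLpNorm_eq_lintegral_rpow_enorm_toReal (p := 2) (by norm_num) (by norm_num),
    ENNReal.toReal_ofNat]
  rw [← ENNReal.mul_rpow_of_nonneg _ _ (by norm_num)]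
  congr 1
  have hv2 : AEMeasurable (fun p : Rn n × Rn n => v p.2) (volume.prod volume) :=
    (hv.comp_quasiMeasurePreserving Measure.quasiMeasurePreserving_snd).aemeasurable
  have hkm2 : Measurable (fun p : Rn n × Rn n => k (p.1 - p.2)) :=
    hkm.comp (measurable_fst.sub measurable_snd)
  rw [Measure.volume_eq_prod, lintegral_prod_symm]
  · have : ∀ y : Rn n, ∫⁻ x : Rn n, ‖k (x - y) * v y‖ₑ ^ (2 : ℝ)
        = (∫⁻ x, ‖k x‖ₑ ^ (2 : ℝ)) * ‖v y‖ₑ ^ (2 : ℝ) := by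
      intro y
      simp only [enorm_mul, ENNReal.mul_rpow_of_nonneg _ _ (zero_le_two (α := ℝ))]
      rw [lintegral_mul_const _ (by fun_prop)]
      congr 1
      exact lintegral_sub_right_eq_self (fun x => ‖k x‖ₑ ^ (2 : ℝ)) y
    simp only [hk] at this
    simp only [this]
    exact lintegral_const_mul'' _ (by have := hv.aemeasurable; fun_prop)
  · exact (hkm2.aemeasurable.mul hv2).enorm.pow_const _

/-- Leibniz splitting: `ζ(x)w(x) - ζ(y)w(y) = ζ(x)(w(x) - w(y)) + (ζ(x) - ζ(y))w(y)`, with `|ζ(x) -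
ζ(y)| ≤ min(2B, L|x - y|)`. -/
theorem mul_mem_sobolevSpace {n : ℕ} (hn : n ≠ 0) {s : ℝ} (hs0 : 0 < s) (hs1 : s < 1)
    {ζ w : Rn n → ℝ} {B : ℝ} {L : ℝ≥0} (hB : ∀ x, |ζ x| ≤ B) (hL : LipschitzWith L ζ)
    (hw : w ∈ sobolevSpace n s) : (fun x => ζ x * w x) ∈ sobolevSpace n s := by
  have hB0 : 0 ≤ B := (abs_nonneg _).trans (hB 0)
  have hζm : AEStronglyMeasurable ζ volume := hL.continuous.aestronglyMeasurable
  have hζw : AEStronglyMeasurable (fun x => ζ x * w x) volume := hζm.mul hw.1.1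
  refine ⟨?_, ?_⟩
  · refine (hw.1.const_mul B).of_le hζw (.of_forall fun x => ?_)
    rw [norm_mul, norm_mul, Real.norm_of_nonneg hB0]
    exact mul_le_mul_of_nonneg_right (hB x) (norm_nonneg _)
  · obtain ⟨C, hC, hk⟩ := exists_eLpNorm_kernel_mul_le hn hs0 hs1
      (B := 2 * B) (L := L) (by positivity) L.2
    set k : Rn n × Rn n → ℝ := fun p => min (2 * B) (L * ‖p.1 - p.2‖) /
        ‖p.1 - p.2‖ ^ (((n : ℝ) + 2 * s) / 2) * w p.2 with hkdef
    have hkm : AEStronglyMeasurable k volume := by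
      have h2 : AEMeasurable (fun p : Rn n × Rn n => w p.2) volume :=
        (hw.1.1.comp_quasiMeasurePreserving Measure.quasiMeasurePreserving_snd).aemeasurable
      exact (AEMeasurable.mul (by fun_prop) h2).aestronglyMeasurable
    have hkL : MemLp k 2 volume :=
      ⟨hkm, (hk w hw.1.1).trans_lt (ENNReal.mul_lt_top hC hw.1.2)⟩
    refine ((hw.2.norm.const_mul B).add hkL.norm).of_le
      (aestronglyMeasurable_gagliardoQuotient hζw) (.of_forall fun p => ?_)
    have e : gagliardoQuotient s (fun x => ζ x * w x) p = ζ p.1 * gagliardoQuotient s w p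
        + (ζ p.1 - ζ p.2) / ‖p.1 - p.2‖ ^ (((n : ℝ) + 2 * s) / 2) * w p.2 := by
      simp only [gagliardoQuotient]; ring
    rw [e, Pi.add_apply]
    refine (norm_add_le _ _).trans (le_trans ?_ (le_abs_self _))
    refine add_le_add ?_ ?_
    · rw [norm_mul]
      exact mul_le_mul_of_nonneg_right (hB _) (norm_nonneg _)
    · rw [hkdef]
      simp only [norm_mul, norm_div]
      gcongr
      rw [Real.norm_of_nonneg (le_min (by positivity) (by positivity))]
      refine le_min ?_ ?_
      · refine (norm_sub_le _ _).trans ?_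
        have h1 := hB p.1; have h2 := hB p.2
        simp only [Real.norm_eq_abs]; linarith
      · have := hL.dist_le_mul p.1 p.2
        rwa [dist_eq_norm, dist_eq_norm] at this

/-! ### Translations and averages in `H^s`. -/

/-- Translations act continuously on `L²` functions. -/
theorem exists_forall_eLpNorm_translate_sub_le {V : Type*} [NormedAddCommGroup V]
    [NormedSpace ℝ V] [FiniteDimensional ℝ V] [MeasurableSpace V] [BorelSpace V]
    (μ : Measure V) [μ.IsAddHaarMeasure] {F : V → ℝ} (hF : MemLp F 2 μ)
    {ε : ℝ≥0∞} (hε : 0 < ε) :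
    ∃ δ > 0, ∀ v : V, ‖v‖ < δ → eLpNorm (fun x => F (x - v) - F x) 2 μ ≤ ε := by
  have : Fact ((2 : ℝ≥0∞) ≠ ⊤) := ⟨by norm_num⟩
  have hcont : Continuous (fun v : V => (DomAddAct.mk (-v)) +ᵥ hF.toLp F) := by
    have h1 : Continuous (fun v : V => DomAddAct.mk (-v)) :=
      DomAddAct.continuous_mk.comp continuous_neg
    exact h1.vadd continuous_const
  have ht := hcont.tendsto 0
  rw [EMetric.tendsto_nhds] at ht
  obtain ⟨δ, hδ, h⟩ := Metric.eventually_nhds_iff.1 (ht ε hε)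
  refine ⟨δ, hδ, fun v hv => ?_⟩
  have h2 := h (y := v) (by simpa using hv)
  rw [neg_zero, DomAddAct.mk_zero, zero_vadd, DomAddAct.mk_vadd_toLp,
    Lp.edist_toLp_toLp] at h2
  refine le_trans (le_of_eq ?_) h2.le
  congr 1
  funext x
  simp [sub_eq_add_neg, add_comm]

theorem gagliardoQuotient_translate_sub {n : ℕ} {s : ℝ} (w : Rn n → ℝ) (h : Rn n) :
    gagliardoQuotient s (fun x => w (x - h) - w x) =
      fun p => gagliardoQuotient s w (p - (h, h)) - gagliardoQuotient s w p := by
  funext p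
  simp only [gagliardoQuotient, Prod.fst_sub, Prod.snd_sub, sub_sub_sub_cancel_right]
  ring

/-- Translating `w` by `h` translates its Gagliardo quotient by `(h, h)`, so continuity of
translations in `L²` applies on `ℝⁿ` and on `ℝⁿ × ℝⁿ`. -/
theorem exists_forall_hsSize_translate_sub_le {n : ℕ} {s : ℝ} {w : Rn n → ℝ}
    (hw : w ∈ sobolevSpace n s) {ε : ℝ≥0∞} (hε : 0 < ε) :
    ∃ δ > 0, ∀ h : Rn n, ‖h‖ < δ → hsSize s (fun x => w (x - h) - w x) ≤ ε := by
  have : (volume : Measure (Rn n × Rn n)).IsAddHaarMeasure := by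
    rw [Measure.volume_eq_prod]; infer_instance
  obtain ⟨δ₁, h1, H1⟩ := exists_forall_eLpNorm_translate_sub_le volume hw.1
    (ENNReal.half_pos hε.ne')
  obtain ⟨δ₂, h2, H2⟩ := exists_forall_eLpNorm_translate_sub_le
    (volume : Measure (Rn n × Rn n)) hw.2 (ENNReal.half_pos hε.ne')
  refine ⟨min δ₁ δ₂, lt_min h1 h2, fun h hh => ?_⟩
  rw [hsSize, gagliardoQuotient_translate_sub, ← ENNReal.add_halves ε]
  refine add_le_add (H1 h (hh.trans_le (min_le_left _ _))) (H2 (h, h) ?_)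
  simpa using hh.trans_le (min_le_right _ _)

/-- The `L²` norm of an average is at most the supremum of the `L²` norms. -/
theorem eLpNorm_two_integral_le {α β : Type*} [MeasurableSpace α] [MeasurableSpace β]
    {P : Measure α} [IsProbabilityMeasure P] {ν : Measure β} [SFinite ν] {Φ : α → β → ℝ}
    (hΦ : Measurable (Function.uncurry Φ)) {ε : ℝ≥0∞}
    (hε : ∀ᵐ a ∂P, eLpNorm (Φ a) 2 ν ≤ ε) :
    eLpNorm (fun b => ∫ a, Φ a b ∂P) 2 ν ≤ ε := by
  have hsq : ∀ t : ℝ≥0∞, (t ^ (1 / (2 : ℝ))) ^ (2 : ℝ) = t := fun t => by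
    rw [← ENNReal.rpow_mul]; norm_num
  have hpt : ∀ b, ‖∫ a, Φ a b ∂P‖ₑ ^ (2 : ℝ) ≤ ∫⁻ a, ‖Φ a b‖ₑ ^ (2 : ℝ) ∂P := by
    intro b
    have hm : Measurable (fun a => Φ a b) := hΦ.comp measurable_prodMk_right
    -- Jensen's inequality, as the comparison of `L¹` and `L²` norms on a probability space.
    have h1 : eLpNorm (fun a => Φ a b) 1 P ≤ eLpNorm (fun a => Φ a b) 2 P :=
      eLpNorm_le_eLpNorm_of_exponent_le (by norm_num) hm.aestronglyMeasurable
    rw [eLpNorm_one_eq_lintegral_enorm,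
      eLpNorm_eq_lintegral_rpow_enorm_toReal (by norm_num) (by norm_num)] at h1
    simp only [ENNReal.toReal_ofNat] at h1
    calc _ ≤ (∫⁻ a, ‖Φ a b‖ₑ ∂P) ^ (2 : ℝ) := by
          gcongr; exact enorm_integral_le_lintegral_enorm _
      _ ≤ ((∫⁻ a, ‖Φ a b‖ₑ ^ (2 : ℝ) ∂P) ^ (1 / (2 : ℝ))) ^ (2 : ℝ) := by gcongr
      _ = _ := hsq _
  rw [eLpNorm_eq_lintegral_rpow_enorm_toReal (by norm_num) (by norm_num)]
  simp only [ENNReal.toReal_ofNat]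
  have hmain : ∫⁻ b, ‖∫ a, Φ a b ∂P‖ₑ ^ (2 : ℝ) ∂ν ≤ ε ^ (2 : ℝ) := by
    calc _ ≤ ∫⁻ b, ∫⁻ a, ‖Φ a b‖ₑ ^ (2 : ℝ) ∂P ∂ν := lintegral_mono hpt
      _ = ∫⁻ a, ∫⁻ b, ‖Φ a b‖ₑ ^ (2 : ℝ) ∂ν ∂P := by
        rw [lintegral_lintegral_swap]
        exact ((hΦ.comp measurable_swap).enorm.pow_const _).aemeasurable
      _ ≤ ∫⁻ a, ε ^ (2 : ℝ) ∂P := by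
        refine lintegral_mono_ae ?_
        filter_upwards [hε] with a ha
        rw [eLpNorm_eq_lintegral_rpow_enorm_toReal (by norm_num) (by norm_num)] at ha
        simp only [ENNReal.toReal_ofNat] at ha
        rw [← hsq (∫⁻ b, ‖Φ a b‖ₑ ^ (2 : ℝ) ∂ν)]
        gcongr
      _ = _ := by simp
  calc _ ≤ (ε ^ (2 : ℝ)) ^ (1 / (2 : ℝ)) := by gcongr
    _ = ε := by rw [← ENNReal.rpow_mul]; norm_num

theorem hsSize_average_le {n : ℕ} {s : ℝ} {P : Measure (Rn n)} [IsProbabilityMeasure P]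
    {w : Rn n → ℝ} (hw : Measurable w) (hint : ∀ x, Integrable (fun h => w (x - h)) P)
    {ε : ℝ≥0∞} (hε : ∀ᵐ h ∂P, hsSize s (fun x => w (x - h) - w x) ≤ ε) :
    hsSize s (fun x => ∫ h, w (x - h) ∂P - w x) ≤ ε + ε := by
  have e1 : (fun x => ∫ h, w (x - h) ∂P - w x) = fun x => ∫ h, (w (x - h) - w x) ∂P := by
    funext x
    rw [integral_sub (hint x) (integrable_const _)]
    simp
  have e2 : gagliardoQuotient s (fun x => ∫ h, w (x - h) ∂P - w x) =
      fun p => ∫ h, gagliardoQuotient s (fun x => w (x - h) - w x) p ∂P := by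
    funext p
    simp only [gagliardoQuotient]
    have hi : ∀ x, Integrable (fun h => w (x - h) - w x) P :=
      fun x => (hint x).sub (integrable_const _)
    rw [integral_div, integral_sub (hi _) (hi _), integral_sub (hint _) (integrable_const _),
      integral_sub (hint _) (integrable_const _)]
    simp
  rw [hsSize, e2, e1]
  refine add_le_add (eLpNorm_two_integral_le ?_ ?_) (eLpNorm_two_integral_le ?_ ?_)
  · simp only [Function.uncurry_def]; fun_prop
  · filter_upwards [hε] with h hh using le_self_add.trans hh
  · simp only [Function.uncurry_def, gagliardoQuotient]; fun_prop
  · filter_upwards [hε] with h hh using le_add_self.trans hh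

/-! ### Approximation by nonnegative test functions. -/

/-- `w` is the limit in `H^s(ℝⁿ)` of nonnegative test functions on `Ω`. -/
def IsLimitOfNonnegTests {n : ℕ} (s : ℝ) (Ω : Set (Rn n)) (w : Rn n → ℝ) : Prop :=
  ∀ ε : ℝ≥0∞, 0 < ε → ∃ φ : testSpace n s Ω, (∀ x, 0 ≤ testFun φ x) ∧
    hsSize s (testFun φ - w) ≤ ε

theorem testFun_mem {n : ℕ} {s : ℝ} {Ω : Set (Rn n)} (φ : testSpace n s Ω) :
    testFun φ ∈ sobolevSpace n s := (φ : sobolevSpace n s).2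

theorem IsLimitOfNonnegTests.of_approx {n : ℕ} {s : ℝ} {Ω : Set (Rn n)} {w : Rn n → ℝ}
    (hw : AEStronglyMeasurable w volume)
    (h : ∀ ε : ℝ≥0∞, 0 < ε → ∃ v, AEStronglyMeasurable v volume ∧ IsLimitOfNonnegTests s Ω v ∧
      hsSize s (v - w) ≤ ε) : IsLimitOfNonnegTests s Ω w := by
  intro ε hε
  obtain ⟨v, hvm, hv, hvw⟩ := h (ε / 2) (ENNReal.half_pos hε.ne')
  obtain ⟨φ, h0, h1⟩ := hv (ε / 2) (ENNReal.half_pos hε.ne')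
  refine ⟨φ, h0, ?_⟩
  have e : testFun φ - w = (testFun φ - v) + (v - w) := by abel
  rw [e, ← ENNReal.add_halves ε]
  exact (hsSize_add_le ((testFun_mem φ).1.1.sub hvm) (hvm.sub hw)).trans (add_le_add h1 hvw)

theorem IsLimitOfNonnegTests.add {n : ℕ} {s : ℝ} {Ω : Set (Rn n)} {v w : Rn n → ℝ}
    (hvm : AEStronglyMeasurable v volume) (hwm : AEStronglyMeasurable w volume)
    (hv : IsLimitOfNonnegTests s Ω v) (hw : IsLimitOfNonnegTests s Ω w) :
    IsLimitOfNonnegTests s Ω (v + w) := by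
  intro ε hε
  obtain ⟨φ, h0, h1⟩ := hv (ε / 2) (ENNReal.half_pos hε.ne')
  obtain ⟨ψ, h2, h3⟩ := hw (ε / 2) (ENNReal.half_pos hε.ne')
  refine ⟨φ + ψ, fun x => add_nonneg (h0 x) (h2 x), ?_⟩
  have e : testFun (φ + ψ) - (v + w) = (testFun φ - v) + (testFun ψ - w) := by
    change testFun φ + testFun ψ - (v + w) = _
    abel
  rw [e, ← ENNReal.add_halves ε]
  exact (hsSize_add_le ((testFun_mem φ).1.1.sub hvm) ((testFun_mem ψ).1.1.sub hwm)).trans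
    (add_le_add h1 h3)

theorem IsLimitOfNonnegTests.zero {n : ℕ} {s : ℝ} {Ω : Set (Rn n)} :
    IsLimitOfNonnegTests s Ω (0 : Rn n → ℝ) := by
  intro ε hε
  refine ⟨0, fun x => le_rfl, ?_⟩
  have e : testFun (0 : testSpace n s Ω) - 0 = 0 := by
    change (0 : Rn n → ℝ) - 0 = 0
    simp
  have h : gagliardoQuotient s (0 : Rn n → ℝ) = 0 := by
    funext p; simp [gagliardoQuotient]
  rw [e, hsSize, h]
  simp

theorem IsLimitOfNonnegTests.sum {n : ℕ} {s : ℝ} {Ω : Set (Rn n)} {ι : Type*} (t : Finset ι)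
    {w : ι → Rn n → ℝ} (hm : ∀ i ∈ t, AEStronglyMeasurable (w i) volume)
    (h : ∀ i ∈ t, IsLimitOfNonnegTests s Ω (w i)) :
    IsLimitOfNonnegTests s Ω (∑ i ∈ t, w i) := by
  classical
  induction t using Finset.induction_on with
  | empty => simpa using IsLimitOfNonnegTests.zero
  | insert a t ha ih =>
    rw [Finset.sum_insert ha]
    have hm' : ∀ i ∈ t, AEStronglyMeasurable (w i) volume :=
      fun i hi => hm i (Finset.mem_insert_of_mem hi)
    exact IsLimitOfNonnegTests.add (hm a (Finset.mem_insert_self _ _))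
      (Finset.aestronglyMeasurable_sum t hm')
      (h a (Finset.mem_insert_self _ _)) (ih hm' fun i hi => h i (Finset.mem_insert_of_mem hi))

/-- Mollification: the convolution is an average of small translates, so its `H^s` error is
controlled by theirs, and it inherits nonnegativity from `w`. The mollifier radius also keeps the
support within `Ω`. -/
theorem isLimitOfNonnegTests_of_compact {n : ℕ} {s : ℝ} {Ω K : Set (Rn n)} (hΩ : IsOpen Ω)
    (hK : IsCompact K) (hKΩ : K ⊆ Ω) {w : Rn n → ℝ} (hw : w ∈ sobolevSpace n s)
    (hwm : Measurable w) (hw0 : ∀ x, 0 ≤ w x) (hwK : ∀ x, x ∉ K → w x = 0) :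
    IsLimitOfNonnegTests s Ω w := by
  intro ε hε
  obtain ⟨δ₁, hδ₁, htr⟩ := exists_forall_hsSize_translate_sub_le hw (ENNReal.half_pos hε.ne')
  obtain ⟨δ₂, hδ₂, hth⟩ := hK.exists_cthickening_subset_open hΩ hKΩ
  have hδ : 0 < min δ₁ δ₂ := lt_min hδ₁ hδ₂
  let ρ : ContDiffBump (0 : Rn n) := ⟨min δ₁ δ₂ / 2, min δ₁ δ₂, half_pos hδ, half_lt_self hδ⟩
  have hρsupp : Function.support (ρ.normed volume) = ball 0 (min δ₁ δ₂) := ρ.support_normed_eq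
  let P : Measure (Rn n) := volume.withDensity fun h => ENNReal.ofReal (ρ.normed volume h)
  have hρm : Measurable fun h => ENNReal.ofReal (ρ.normed volume h) :=
    ρ.continuous_normed.measurable.ennreal_ofReal
  have hP : IsProbabilityMeasure P := by
    constructor
    rw [withDensity_apply _ MeasurableSet.univ, Measure.restrict_univ,
      ← ofReal_integral_eq_lintegral_ofReal ρ.integrable_normed
      (.of_forall fun x => ρ.nonneg_normed x), ρ.integral_normed, ENNReal.ofReal_one]
  have hloc : LocallyIntegrable w volume := hw.1.locallyIntegrable (by norm_num)
  have hlt : ∀ᵐ h ∂(volume : Measure (Rn n)), ENNReal.ofReal (ρ.normed volume h) < ⊤ :=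
    .of_forall fun h => ENNReal.ofReal_lt_top
  have htoReal : ∀ h, (ENNReal.ofReal (ρ.normed volume h)).toReal = ρ.normed volume h :=
    fun h => ENNReal.toReal_ofReal (ρ.nonneg_normed h)
  have hint : ∀ x, Integrable (fun h => w (x - h)) P := by
    intro x
    rw [integrable_withDensity_iff_integrable_smul' hρm hlt]
    simp only [htoReal]
    exact (ρ.hasCompactSupport_normed.convolutionExists_left
      (ContinuousLinearMap.lsmul ℝ ℝ) ρ.continuous_normed hloc x).integrable
  have hconv : (fun x => ∫ h, w (x - h) ∂P) =
      convolution (ρ.normed volume) w (ContinuousLinearMap.lsmul ℝ ℝ) volume := by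
    funext x
    rw [integral_withDensity_eq_integral_toReal_smul hρm hlt]
    simp only [htoReal]
    rfl
  set φ : Rn n → ℝ := fun x => ∫ h, w (x - h) ∂P with hφ
  have hsmooth : ContDiff ℝ ∞ φ := by
    rw [hconv]
    exact ρ.hasCompactSupport_normed.contDiff_convolution_left _ ρ.contDiff_normed hloc
  have hsub : tsupport φ ⊆ cthickening δ₂ K := by
    refine closure_minimal ?_ isClosed_cthickening
    intro x hx
    rw [hconv] at hx
    obtain ⟨a, ha, b, hb, rfl⟩ := support_convolution_subset _ hx
    rw [hρsupp] at ha
    have hbK : b ∈ K := by by_contra hb'; exact hb (hwK b hb')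
    refine mem_cthickening_of_dist_le _ b _ _ hbK ?_
    have : ‖a‖ < min δ₁ δ₂ := by simpa using ha
    simpa using this.le.trans (min_le_right _ _)
  have hae : ∀ᵐ h ∂P, hsSize s (fun x => w (x - h) - w x) ≤ ε / 2 := by
    rw [ae_withDensity_iff hρm]
    refine .of_forall fun h hh => htr h ?_
    have : h ∈ Function.support (ρ.normed volume) := by
      intro h0; simp [h0] at hh
    rw [hρsupp] at this
    have h2 : ‖h‖ < min δ₁ δ₂ := by simpa using this
    exact h2.trans_le (min_le_left _ _)
  -- Membership of the mollification in `H^s` is read off from a finite error bound, so `ε = ⊤`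
  -- needs its own witness.
  by_cases hεt : ε = ⊤
  · subst hεt
    obtain ⟨φ, h0, -⟩ := IsLimitOfNonnegTests.zero (s := s) (Ω := Ω) 1 (by norm_num)
    exact ⟨φ, h0, le_top⟩
  have hsize : hsSize s (φ - w) ≤ ε := by
    have := hsSize_average_le hwm hint hae
    rwa [ENNReal.add_halves] at this
  have hmem : φ ∈ sobolevSpace n s := by
    have h1 : φ - w ∈ sobolevSpace n s :=
      mem_sobolevSpace_iff.2 ⟨hsmooth.continuous.aestronglyMeasurable.sub hw.1.1,
        hsize.trans_lt (lt_top_iff_ne_top.2 hεt)⟩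
    have := add_mem h1 hw
    rwa [sub_add_cancel] at this
  have hcs : HasCompactSupport φ := hK.cthickening.of_isClosed_subset isClosed_closure hsub
  exact ⟨⟨⟨φ, hmem⟩, hsmooth, hcs, hsub.trans hth⟩,
    fun x => integral_nonneg fun h => hw0 _, hsize⟩

theorem translate_mem_sobolevSpace {n : ℕ} {s : ℝ} {w : Rn n → ℝ} (hw : w ∈ sobolevSpace n s)
    (hwm : Measurable w) {h : Rn n} (hh : hsSize s (fun x => w (x - h) - w x) < ⊤) :
    (fun x => w (x - h)) ∈ sobolevSpace n s := by
  have h1 : (fun x => w (x - h) - w x) ∈ sobolevSpace n s :=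
    mem_sobolevSpace_iff.2 ⟨by fun_prop, hh⟩
  convert add_mem h1 hw using 1
  funext x
  simp

theorem isLimitOfNonnegTests_of_translate {n : ℕ} {s : ℝ} {Ω K : Set (Rn n)} (hΩ : IsOpen Ω)
    (hK : IsCompact K) {w : Rn n → ℝ} (hw : w ∈ sobolevSpace n s)
    (hwm : Measurable w) (hw0 : ∀ x, 0 ≤ w x) (hwK : ∀ x, x ∉ K → w x = 0)
    (htr : ∀ δ > 0, ∃ h : Rn n, ‖h‖ < δ ∧ ∀ x ∈ K, x + h ∈ Ω) :
    IsLimitOfNonnegTests s Ω w := by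
  refine .of_approx hw.1.1 fun ε hε => ?_
  -- The cap `1` keeps the error finite, so that the translate belongs to `H^s`.
  obtain ⟨δ, hδ, hd⟩ := exists_forall_hsSize_translate_sub_le hw
    (ε := min ε 1) (lt_min hε one_pos)
  obtain ⟨h, hh, hKh⟩ := htr δ hδ
  have hle := hd h hh
  have hmem := translate_mem_sobolevSpace hw hwm
    (hle.trans_lt ((min_le_right _ _).trans_lt ENNReal.one_lt_top))
  refine ⟨fun x => w (x - h), hmem.1.1, ?_, hle.trans (min_le_left _ _)⟩
  refine isLimitOfNonnegTests_of_compact hΩ (hK.image (continuous_add_const h))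
    ?_ hmem (by fun_prop) (fun x => hw0 _) ?_
  · rintro _ ⟨x, hx, rfl⟩; exact hKh x hx
  · intro x hx
    refine hwK _ fun hx' => hx ⟨x - h, hx', by simp⟩

/-! ### Geometry of the boundary. -/

theorem orthogonalProjectionOnto_add_smul_span {n : ℕ} (ν x : Rn n) (t : ℝ) :
    (Submodule.span ℝ {ν})ᗮ.orthogonalProjectionOnto (x + t • ν) =
      (Submodule.span ℝ {ν})ᗮ.orthogonalProjectionOnto x := by
  have : (Submodule.span ℝ {ν})ᗮ.orthogonalProjectionOnto ν = 0 := by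
    rw [Submodule.orthogonalProjectionOnto_eq_zero_iff]
    exact Submodule.le_orthogonal_orthogonal _ (Submodule.mem_span_singleton_self ν)
  rw [map_add, map_smul, this, smul_zero, add_zero]

theorem inner_add_smul_self {n : ℕ} {ν : Rn n} (hν : ‖ν‖ = 1) (x : Rn n) (t : ℝ) :
    ⟪ν, x + t • ν⟫_ℝ = ⟪ν, x⟫_ℝ + t := by
  rw [inner_add_right, real_inner_smul_right, real_inner_self_eq_norm_sq, hν]; ring

theorem graph_le_of_mem_closure {n : ℕ} {Ω : Set (Rn n)} {p ν : Rn n}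
    {γ : (Submodule.span ℝ {ν})ᗮ → ℝ} (hγ : Continuous γ) {ρ : ℝ}
    (h : ∀ x ∈ ball p ρ,
        x ∈ Ω ↔ γ ((Submodule.span ℝ {ν})ᗮ.orthogonalProjectionOnto x) < ⟪ν, x⟫_ℝ)
    {x : Rn n} (hx : x ∈ closure Ω) (hxp : x ∈ ball p ρ) :
    γ ((Submodule.span ℝ {ν})ᗮ.orthogonalProjectionOnto x) ≤ ⟪ν, x⟫_ℝ := by
  have hcl : IsClosed {x : Rn n |
      γ ((Submodule.span ℝ {ν})ᗮ.orthogonalProjectionOnto x) ≤ ⟪ν, x⟫_ℝ} :=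
    isClosed_le (by fun_prop) (by fun_prop)
  have h1 : x ∈ closure (ball p ρ ∩ Ω) := isOpen_ball.inter_closure ⟨hxp, hx⟩
  exact closure_minimal (fun y hy => ((h y hy.1).1 hy.2).le) hcl h1

/-- Locally the boundary lies in a graph over the orthogonal complement of `ν`. Its translates by
`ν/(k+1)` are pairwise disjoint with bounded shifts, which is impossible for a set of positive
measure. -/
theorem volume_frontier_eq_zero {n : ℕ} {Ω : Set (Rn n)} (hΩ : IsBoundedC11Domain Ω) :
    volume (frontier Ω) = 0 := by
  refine measure_null_of_locally_null _ fun p hp => ?_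
  obtain ⟨ν, hν, γ, hγ, -, ρ, hρ, h⟩ := hΩ.boundary p hp
  refine ⟨frontier Ω ∩ ball p ρ,
    Filter.inter_mem self_mem_nhdsWithin (mem_nhdsWithin_of_mem_nhds (ball_mem_nhds p hρ)), ?_⟩
  have hinj : Function.Injective (fun k : ℕ => ((1 : ℝ) / (k + 1)) • ν) := by
    intro k l hkl
    have hν0 : ν ≠ 0 := by rintro rfl; simp at hν
    have h1 := smul_left_injective ℝ hν0 hkl
    have h2 : ((k : ℝ) + 1) = l + 1 := by
      have := congrArg (fun x : ℝ => 1 / x) h1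
      simpa using this
    exact_mod_cast add_right_cancel h2
  have hgraph : ∀ x ∈ frontier Ω ∩ ball p ρ,
      γ ((Submodule.span ℝ {ν})ᗮ.orthogonalProjectionOnto x) = ⟪ν, x⟫_ℝ := by
    rintro x ⟨hx, hxp⟩
    refine le_antisymm (graph_le_of_mem_closure hγ.continuous h hx.1 hxp) ?_
    have : x ∉ Ω := by
      have := hx.2; rwa [hΩ.isOpen.interior_eq] at this
    rw [h x hxp] at this
    exact not_lt.1 this
  refine Measure.addHaar_eq_zero_of_disjoint_translates volume
    (u := fun k : ℕ => ((1 : ℝ) / (k + 1)) • ν) ?_ ?_ ?_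
  · refine (isBounded_closedBall (x := (0 : Rn n)) (r := 1)).subset ?_
    rintro _ ⟨k, rfl⟩
    have hk : (0 : ℝ) < k + 1 := by positivity
    simp only [mem_closedBall, dist_zero_right, norm_smul, hν, mul_one, Real.norm_eq_abs]
    rw [abs_of_pos (by positivity), div_le_one hk]
    linarith [(Nat.cast_nonneg k : (0 : ℝ) ≤ k)]
  · intro k l hkl
    rw [Function.onFun, Set.disjoint_left]
    rintro _ ⟨a, ha, x, hx, rfl⟩ ⟨b, hb, y, hy, hxy⟩
    rw [mem_singleton_iff] at ha hb
    subst ha hb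
    have gx := hgraph x hx
    have gy := hgraph y hy
    apply hkl
    have e : x = y + ((1 : ℝ) / (l + 1) - 1 / (k + 1)) • ν := by
      have hxy' : ((1 : ℝ) / (l + 1)) • ν + y = ((1 : ℝ) / (k + 1)) • ν + x := hxy
      rw [sub_smul, ← sub_eq_zero]
      rw [← sub_eq_zero] at hxy'
      rw [← neg_eq_zero, ← hxy']
      abel
    rw [e, orthogonalProjectionOnto_add_smul_span, inner_add_smul_self hν, gy] at gx
    apply hinj
    have : (1 : ℝ) / (k + 1) = 1 / (l + 1) := by linarith
    simp only [this]
  · exact (isClosed_frontier.measurableSet).inter measurableSet_ball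

/-- Moving along `ν` keeps the base coordinate and raises the height, so points on or above the
graph end strictly above it. Compactness of `K` leaves room to stay in the ball where the graph
description holds. -/
theorem exists_ball_translate_subset {n : ℕ} {Ω : Set (Rn n)} (hΩ : IsBoundedC11Domain Ω)
    {p : Rn n} (hp : p ∈ closure Ω) :
    ∃ ρ > 0, ∀ K : Set (Rn n), IsCompact K → K ⊆ ball p ρ → K ⊆ closure Ω →
      ∀ δ > 0, ∃ h : Rn n, ‖h‖ < δ ∧ ∀ x ∈ K, x + h ∈ Ω := by
  by_cases hpΩ : p ∈ Ω
  · obtain ⟨ρ, hρ, hb⟩ := Metric.isOpen_iff.1 hΩ.isOpen p hpΩ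
    refine ⟨ρ, hρ, fun K _ hK1 _ δ hδ => ⟨0, by simpa using hδ, fun x hx => ?_⟩⟩
    simpa using hb (hK1 hx)
  · have hpf : p ∈ frontier Ω := ⟨hp, by rwa [hΩ.isOpen.interior_eq]⟩
    obtain ⟨ν, hν, γ, hγ, -, ρ, hρ, h⟩ := hΩ.boundary p hpf
    refine ⟨ρ, hρ, fun K hK hK1 hK2 δ hδ => ?_⟩
    obtain ⟨η, hη, hth⟩ := hK.exists_cthickening_subset_open isOpen_ball hK1
    set t := min (δ / 2) η
    have ht : 0 < t := lt_min (half_pos hδ) hη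
    have hnorm : ‖t • ν‖ = t := by rw [norm_smul, hν, mul_one, Real.norm_of_nonneg ht.le]
    refine ⟨t • ν, ?_, fun x hx => ?_⟩
    · rw [hnorm]; exact (min_le_left _ _).trans_lt (half_lt_self hδ)
    · have hb : x + t • ν ∈ ball p ρ := by
        refine hth (mem_cthickening_of_dist_le _ x _ _ hx ?_)
        rw [dist_self_add_left, hnorm]
        exact min_le_right _ _
      rw [h _ hb, orthogonalProjectionOnto_add_smul_span, inner_add_smul_self hν]
      have := graph_le_of_mem_closure hγ.continuous h (hK2 hx) (hK1 hx)
      linarith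

/-- Nonnegative functions of `H^s(ℝⁿ)` which vanish outside a `C^{1,1}` domain are limits of
nonnegative test functions on it. -/
theorem isLimitOfNonnegTests_of_eq_zero_compl {n : ℕ} (hn : n ≠ 0) {s : ℝ} (hs0 : 0 < s)
    (hs1 : s < 1) {Ω : Set (Rn n)} (hΩ : IsBoundedC11Domain Ω) {w : Rn n → ℝ}
    (hw : w ∈ sobolevSpace n s) (hwm : Measurable w) (hw0 : ∀ x, 0 ≤ w x)
    (hwΩ : ∀ x, x ∉ Ω → w x = 0) : IsLimitOfNonnegTests s Ω w := by
  have hcomp : IsCompact (closure Ω) := hΩ.isBounded.isCompact_closure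
  choose! R hR0 hR using fun p (hp : p ∈ closure Ω) => exists_ball_translate_subset hΩ hp
  obtain ⟨t, htcov⟩ := hcomp.elim_nhds_subcover' (fun p _ => ball p (R p))
    (fun p hp => ball_mem_nhds p (hR0 p hp))
  -- Each piece `ζ i * w` lives in a single ball, where one translation direction pushes it into
  -- `Ω`.
  obtain ⟨ζ, hζ⟩ := SmoothPartitionOfUnity.exists_isSubordinate (modelWithCornersSelf ℝ (Rn n))
    hcomp.isClosed (fun i : t => ball (i : Rn n) (R i)) (fun i => isOpen_ball)
    (by
      refine htcov.trans (iUnion₂_subset fun i hi => ?_)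
      exact subset_iUnion (fun i : t => ball (i : Rn n) (R i)) ⟨i, hi⟩)
  have hsum : w = ∑ i ∈ (Finset.univ : Finset t), fun x => ζ i x * w x := by
    funext x
    rw [Finset.sum_apply]
    by_cases hx : x ∈ Ω
    · have h1 := ζ.sum_eq_one (subset_closure hx)
      rw [finsum_eq_sum_of_fintype] at h1
      rw [← Finset.sum_mul, h1, one_mul]
    · simp [hwΩ x hx]
  have hsm : ∀ i, ContDiff ℝ ∞ (ζ i) := fun i => (ζ i).contMDiff.contDiff
  have hmeas : ∀ i, Measurable (fun x => ζ i x * w x) :=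
    fun i => (hsm i).continuous.measurable.mul hwm
  rw [hsum]
  refine IsLimitOfNonnegTests.sum _ (fun i _ => (hmeas i).aestronglyMeasurable) fun i _ => ?_
  have hic : ((i : closure Ω) : Rn n) ∈ closure Ω := (i : closure Ω).2
  have hcs : HasCompactSupport (ζ i) :=
    isCompact_of_isClosed_isBounded isClosed_closure (isBounded_ball.subset (hζ i))
  obtain ⟨L, hL⟩ := (hsm i).lipschitzWith_of_hasCompactSupport hcs (by simp)
  have hmem : (fun x => ζ i x * w x) ∈ sobolevSpace n s :=
    mul_mem_sobolevSpace hn hs0 hs1 (B := 1)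
      (fun x => by rw [abs_of_nonneg (ζ.nonneg i x)]; exact ζ.le_one i x) hL hw
  have hK : IsCompact (tsupport (ζ i) ∩ closure Ω) := hcs.inter_right isClosed_closure
  refine isLimitOfNonnegTests_of_translate hΩ.isOpen hK hmem (hmeas i)
    (fun x => mul_nonneg (ζ.nonneg i x) (hw0 x)) ?_
    (hR _ hic _ hK (inter_subset_left.trans (hζ i)) inter_subset_right)
  intro x hx
  by_cases hxΩ : x ∈ Ω
  · have : x ∉ tsupport (ζ i) := fun h => hx ⟨h, subset_closure hxΩ⟩
    rw [image_eq_zero_of_notMem_tsupport this, zero_mul]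
  · rw [hwΩ x hxΩ, mul_zero]

/-! ### Boundedness of the magnetic form. -/

/-- The difference quotient `(u(x) - e^{iθ(x,y)} u(y)) / |x - y|^{(n+2s)/2}`. -/
noncomputable def magneticQuotient {n : ℕ} (s : ℝ) (θ : Rn n × Rn n → ℝ) (u : Rn n → ℝ) (p : Rn n × Rn n) : ℂ :=
  ((u p.1 : ℂ) - Complex.exp (Complex.I * (θ p : ℂ)) * (u p.2 : ℂ)) /
    ((‖p.1 - p.2‖ ^ (((n : ℝ) + 2 * s) / 2) : ℝ) : ℂ)

theorem aestronglyMeasurable_magneticQuotient {n : ℕ} {s : ℝ} {θ : Rn n × Rn n → ℝ}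
    (hθ : AEMeasurable θ volume) {u : Rn n → ℝ} (hu : AEStronglyMeasurable u volume) :
    AEStronglyMeasurable (magneticQuotient s θ u) volume := by
  have h1 : AEMeasurable (fun p : Rn n × Rn n => u p.1) volume :=
    (hu.comp_quasiMeasurePreserving Measure.quasiMeasurePreserving_fst).aemeasurable
  have h2 : AEMeasurable (fun p : Rn n × Rn n => u p.2) volume :=
    (hu.comp_quasiMeasurePreserving Measure.quasiMeasurePreserving_snd).aemeasurable
  have h3 : Measurable (fun p : Rn n × Rn n =>
      ((‖p.1 - p.2‖ ^ (((n : ℝ) + 2 * s) / 2) : ℝ) : ℂ)) := by fun_prop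
  have h4 : AEMeasurable (fun p : Rn n × Rn n => (u p.1 : ℂ) -
      Complex.exp (Complex.I * (θ p : ℂ)) * (u p.2 : ℂ)) volume := by fun_prop
  exact (h4.div h3.aemeasurable).aestronglyMeasurable

theorem magneticQuotient_sub {n : ℕ} {s : ℝ} {θ : Rn n × Rn n → ℝ} (u v : Rn n → ℝ) :
    magneticQuotient s θ (u - v) = magneticQuotient s θ u - magneticQuotient s θ v := by
  funext p
  simp only [magneticQuotient, Pi.sub_apply, Complex.ofReal_sub]
  ring

/-- The quotient differs from Gagliardo's by `(e^{iθ} - 1) u(y)` over the weight, and `|e^{iθ} - 1|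
≤ min(2, M|x - y|)` puts this term under the truncated-kernel bound. -/
theorem exists_eLpNorm_magneticQuotient_le {n : ℕ} (hn : n ≠ 0) {s : ℝ} (hs0 : 0 < s)
    (hs1 : s < 1) {θ : Rn n × Rn n → ℝ} {M : ℝ} (hM : 0 ≤ M)
    (hθM : ∀ᵐ p : Rn n × Rn n, |θ p| ≤ M * ‖p.1 - p.2‖) :
    ∃ C : ℝ≥0∞, C < ⊤ ∧ ∀ u : Rn n → ℝ, AEStronglyMeasurable u volume →
      eLpNorm (magneticQuotient s θ u) 2 volume ≤ C * hsSize s u := by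
  obtain ⟨C, hC, hk⟩ := exists_eLpNorm_kernel_mul_le hn hs0 hs1 (B := 2) (L := M) zero_le_two hM
  refine ⟨1 + C, ENNReal.add_lt_top.2 ⟨ENNReal.one_lt_top, hC⟩, fun u hu => ?_⟩
  set k : Rn n × Rn n → ℝ := fun p => min 2 (M * ‖p.1 - p.2‖) /
        ‖p.1 - p.2‖ ^ (((n : ℝ) + 2 * s) / 2) * u p.2 with hkdef
  have hkm : AEStronglyMeasurable k volume := by
    have h2 : AEMeasurable (fun p : Rn n × Rn n => u p.2) volume :=
      (hu.comp_quasiMeasurePreserving Measure.quasiMeasurePreserving_snd).aemeasurable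
    exact (AEMeasurable.mul (by fun_prop) h2).aestronglyMeasurable
  have hGm := aestronglyMeasurable_gagliardoQuotient (s := s) hu
  have hle : ∀ᵐ p : Rn n × Rn n, ‖magneticQuotient s θ u p‖ ≤
      ‖((fun p => ‖gagliardoQuotient s u p‖) + fun p => ‖k p‖) p‖ := by
    filter_upwards [hθM] with p hp
    have e : magneticQuotient s θ u p = (gagliardoQuotient s u p : ℂ) -
        (Complex.exp (Complex.I * (θ p : ℂ)) - 1) /
          ((‖p.1 - p.2‖ ^ (((n : ℝ) + 2 * s) / 2) : ℝ) : ℂ) * (u p.2 : ℂ) := by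
      simp only [magneticQuotient, gagliardoQuotient, Complex.ofReal_div, Complex.ofReal_sub]
      ring
    rw [e]
    refine (norm_sub_le _ _).trans (le_trans ?_ (le_abs_self _))
    refine add_le_add (by rw [Complex.norm_real]) ?_
    rw [hkdef]
    simp only [norm_mul, norm_div, Complex.norm_real]
    gcongr
    rw [Real.norm_of_nonneg (le_min zero_le_two (by positivity))]
    refine le_min ?_ (Real.norm_exp_I_mul_ofReal_sub_one_le.trans hp)
    refine (norm_sub_le _ _).trans ?_
    rw [mul_comm, Complex.norm_exp_ofReal_mul_I, norm_one]
    norm_num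
  refine (eLpNorm_mono_ae hle).trans ?_
  refine (eLpNorm_add_le hGm.norm hkm.norm (by norm_num)).trans ?_
  rw [eLpNorm_norm, eLpNorm_norm, add_mul, one_mul]
  refine add_le_add le_add_self ((hk u hu).trans ?_)
  gcongr
  exact le_self_add

theorem quasiMeasurePreserving_midpoint (n : ℕ) :
    Measure.QuasiMeasurePreserving (fun p : Rn n × Rn n => (1 / 2 : ℝ) • (p.1 + p.2))
      volume volume :=
  (Measure.quasiMeasurePreserving_smul volume (by norm_num : (1 / 2 : ℝ) ≠ 0)).comp
    (quasiMeasurePreserving_add volume volume)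

theorem aemeasurable_magneticPhase {n : ℕ} {A : Rn n → Rn n}
    (hA : AEStronglyMeasurable A volume) :
    AEMeasurable (fun p : Rn n × Rn n => magneticPhase A p.1 p.2) volume := by
  have h1 : AEMeasurable (fun p : Rn n × Rn n => A ((1 / 2 : ℝ) • (p.1 + p.2))) volume :=
    (hA.comp_quasiMeasurePreserving (quasiMeasurePreserving_midpoint n)).aemeasurable
  have h2 : AEMeasurable (fun p : Rn n × Rn n => p.1 - p.2) volume := by fun_prop
  exact h2.inner h1

theorem magneticForm_eq {n : ℕ} {s : ℝ} (hs0 : 0 < s) (A : Rn n → Rn n) (u v : Rn n → ℝ) :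
    magneticForm s A u v = (∫ p : Rn n × Rn n,
      (fracConst n s : ℂ) * (magneticQuotient s (fun p => magneticPhase A p.1 p.2) u p *
        magneticQuotient s (fun p => -magneticPhase A p.1 p.2) v p)).re := by
  rw [magneticForm]
  congr 2
  funext p
  have ha : (n : ℝ) + 2 * s = ((n : ℝ) + 2 * s) / 2 + ((n : ℝ) + 2 * s) / 2 := by ring
  have h1 : ‖p.1 - p.2‖ ^ ((n : ℝ) + 2 * s) = ‖p.1 - p.2‖ ^ (((n : ℝ) + 2 * s) / 2) *
      ‖p.1 - p.2‖ ^ (((n : ℝ) + 2 * s) / 2) := by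
    conv_lhs => rw [ha]
    -- Nonnegative exponents make the splitting valid on the diagonal as well.
    exact Real.rpow_add_of_nonneg (norm_nonneg _) (by positivity) (by positivity)
  simp only [magneticQuotient, fracKernel, h1, Complex.ofReal_div, Complex.ofReal_mul,
    Complex.ofReal_neg, mul_neg]
  ring

section Form

variable {n : ℕ} {s M : ℝ} {A : Rn n → Rn n} {u : Rn n → ℝ}

theorem memLp_magneticQuotient (hn : n ≠ 0) (hs0 : 0 < s) (hs1 : s < 1) (hM : 0 ≤ M)
    {θ : Rn n × Rn n → ℝ} (hθ : AEMeasurable θ volume)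
    (hθM : ∀ᵐ p : Rn n × Rn n, |θ p| ≤ M * ‖p.1 - p.2‖) (hu : u ∈ sobolevSpace n s) :
    MemLp (magneticQuotient s θ u) 2 volume := by
  obtain ⟨C, hC, h⟩ := exists_eLpNorm_magneticQuotient_le hn hs0 hs1 hM hθM
  exact ⟨aestronglyMeasurable_magneticQuotient hθ hu.1.1,
    (h u hu.1.1).trans_lt (ENNReal.mul_lt_top hC (mem_sobolevSpace_iff.1 hu).2)⟩

theorem integrable_magneticForm (hn : n ≠ 0) (hs0 : 0 < s) (hs1 : s < 1) (hM : 0 ≤ M)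
    (hA : AEStronglyMeasurable A volume)
    (hθM : ∀ᵐ p : Rn n × Rn n, |magneticPhase A p.1 p.2| ≤ M * ‖p.1 - p.2‖)
    (hu : u ∈ sobolevSpace n s) {v : Rn n → ℝ} (hv : v ∈ sobolevSpace n s) :
    Integrable (fun p : Rn n × Rn n =>
      (fracConst n s : ℂ) * (magneticQuotient s (fun p => magneticPhase A p.1 p.2) u p *
        magneticQuotient s (fun p => -magneticPhase A p.1 p.2) v p)) := by
  have hθ := aemeasurable_magneticPhase hA
  have h1 := memLp_magneticQuotient hn hs0 hs1 hM hθ hθM hu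
  have h2 := memLp_magneticQuotient hn hs0 hs1 hM hθ.neg
    (by simpa only [Pi.neg_apply, abs_neg] using hθM) hv
  exact (h1.integrable_mul h2).const_mul _

theorem magneticForm_sub (hn : n ≠ 0) (hs0 : 0 < s) (hs1 : s < 1) (hM : 0 ≤ M)
    (hA : AEStronglyMeasurable A volume)
    (hθM : ∀ᵐ p : Rn n × Rn n, |magneticPhase A p.1 p.2| ≤ M * ‖p.1 - p.2‖)
    (hu : u ∈ sobolevSpace n s) {v w : Rn n → ℝ} (hv : v ∈ sobolevSpace n s)
    (hw : w ∈ sobolevSpace n s) :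
    magneticForm s A u (v - w) = magneticForm s A u v - magneticForm s A u w := by
  simp only [magneticForm_eq hs0]
  rw [← Complex.sub_re, ← integral_sub (integrable_magneticForm hn hs0 hs1 hM hA hθM hu hv)
    (integrable_magneticForm hn hs0 hs1 hM hA hθM hu hw)]
  congr 2
  funext p
  rw [magneticQuotient_sub, Pi.sub_apply]
  ring

/-- Cauchy–Schwarz for the two magnetic quotients, with phases `θ` and `-θ`. -/
theorem exists_magneticForm_le (hn : n ≠ 0) (hs0 : 0 < s) (hs1 : s < 1) (hM : 0 ≤ M)
    (hA : AEStronglyMeasurable A volume)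
    (hθM : ∀ᵐ p : Rn n × Rn n, |magneticPhase A p.1 p.2| ≤ M * ‖p.1 - p.2‖)
    (hu : u ∈ sobolevSpace n s) :
    ∃ C : ℝ≥0∞, C < ⊤ ∧ ∀ v ∈ sobolevSpace n s, ‖magneticForm s A u v‖ₑ ≤ C * hsSize s v := by
  have hθ := aemeasurable_magneticPhase hA
  have hθM' : ∀ᵐ p : Rn n × Rn n, |-magneticPhase A p.1 p.2| ≤ M * ‖p.1 - p.2‖ := by
    simpa only [abs_neg] using hθM
  obtain ⟨C, hC, h⟩ := exists_eLpNorm_magneticQuotient_le hn hs0 hs1 hM hθM'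
  have h1 := memLp_magneticQuotient hn hs0 hs1 hM hθ hθM hu
  refine ⟨‖(fracConst n s : ℂ)‖ₑ *
    (eLpNorm (magneticQuotient s (fun p => magneticPhase A p.1 p.2) u) 2 volume * C),
    ENNReal.mul_lt_top enorm_lt_top (ENNReal.mul_lt_top h1.2 hC), fun v hv => ?_⟩
  have hvm : AEStronglyMeasurable
      (magneticQuotient s (fun p => -magneticPhase A p.1 p.2) v) volume :=
    aestronglyMeasurable_magneticQuotient hθ.neg hv.1.1
  rw [magneticForm_eq hs0, integral_const_mul]
  have hre : ∀ z : ℂ, ‖z.re‖ₑ ≤ ‖z‖ₑ := fun z =>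
    enorm_le_iff_norm_le.2 (by simpa using Complex.abs_re_le_norm z)
  refine (hre _).trans ?_
  rw [enorm_mul, mul_assoc, mul_assoc]
  gcongr
  refine (enorm_integral_le_lintegral_enorm _).trans ?_
  have hmul := eLpNorm_smul_le_mul_eLpNorm (p := 2) (q := 2) (r := 1) hvm h1.1
  rw [eLpNorm_one_eq_lintegral_enorm] at hmul
  refine hmul.trans ?_
  gcongr
  exact h v hv.1.1

end Form

/-! ### Sign of the form on the negative part. -/

theorem ae_eq_zero_of_notMem_essSupport {n : ℕ} (A : Rn n → Rn n) :
    ∀ᵐ x, x ∉ essSupport A → A x = 0 := by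
  have h0 : volume ({x | A x ≠ 0} ∩ (essSupport A)ᶜ) = 0 := by
    refine measure_null_of_locally_null _ fun x hx => ?_
    obtain ⟨-, hx⟩ := hx
    simp only [essSupport, mem_compl_iff, mem_ofPred_eq, not_forall, not_not] at hx
    obtain ⟨U, hU, hxU, hAU⟩ := hx
    refine ⟨({x | A x ≠ 0} ∩ (essSupport A)ᶜ) ∩ U,
      Filter.inter_mem self_mem_nhdsWithin (mem_nhdsWithin_of_mem_nhds (hU.mem_nhds hxU)), ?_⟩
    rw [ae_restrict_iff' hU.measurableSet] at hAU
    rw [ae_iff] at hAU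
    refine measure_mono_null (fun y hy => ?_) hAU
    exact fun h => hy.1.1 (h hy.2)
  rw [ae_iff]
  refine measure_mono_null (fun x hx => ?_) h0
  simp only [mem_ofPred_eq, Classical.not_imp] at hx
  exact ⟨hx.2, hx.1⟩

theorem norm_le_of_abs_le_div {n : ℕ} (hn : n ≠ 0) {r b : ℝ} (hr : 0 < r) (hb : 0 ≤ b) {a : Rn n}
    (h : ∀ i, |a i| ≤ b / (8 * √(n : ℝ) * r)) : ‖a‖ ≤ b / (8 * r) := by
  have hn' : (0 : ℝ) < n := by exact_mod_cast Nat.pos_of_ne_zero hn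
  have hsq : √(n : ℝ) ^ 2 = n := Real.sq_sqrt hn'.le
  have hs : 0 < √(n : ℝ) := Real.sqrt_pos.2 hn'
  rw [EuclideanSpace.norm_eq, Real.sqrt_le_left (by positivity)]
  calc ∑ i, ‖a i‖ ^ 2 ≤ ∑ _i : Fin n, (b / (8 * √(n : ℝ) * r)) ^ 2 := by
        gcongr with i; exact h i
    _ = n * (b / (8 * √(n : ℝ) * r)) ^ 2 := by simp
    _ = (b / (8 * r)) ^ 2 := by
        simp only [div_pow, mul_pow, hsq]; field_simp

/-- If the midpoint lies in `B_r` along with one endpoint, then `|x - y|` is twice the distance from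
that endpoint to the midpoint, hence at most `4r`, and `4r · π/(8r) = π/2`. Otherwise the phase is
zero. -/
theorem cos_magneticPhase_nonneg {n : ℕ} {A : Rn n → Rn n} {r : ℝ} (hr : 0 < r) {x y : Rn n}
    (hA : ‖A ((1 / 2 : ℝ) • (x + y))‖ ≤ Real.pi / (8 * r))
    (hsupp : (1 / 2 : ℝ) • (x + y) ∉ ball 0 r → A ((1 / 2 : ℝ) • (x + y)) = 0)
    (hxy : x ∈ ball 0 r ∨ y ∈ ball 0 r) : 0 ≤ Real.cos (magneticPhase A x y) := by
  by_cases hz : (1 / 2 : ℝ) • (x + y) ∈ ball 0 r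
  · have hdist : ‖x - y‖ ≤ 4 * r := by
      have hz' : ‖(1 / 2 : ℝ) • (x + y)‖ < r := by simpa using hz
      rcases hxy with hx | hy
      · have hx' : ‖x‖ < r := by simpa using hx
        have e : x - y = (2 : ℝ) • (x - (1 / 2 : ℝ) • (x + y)) := by module
        rw [e, norm_smul, Real.norm_of_nonneg zero_le_two]
        linarith [norm_sub_le x ((1 / 2 : ℝ) • (x + y))]
      · have hy' : ‖y‖ < r := by simpa using hy
        have e : x - y = (2 : ℝ) • ((1 / 2 : ℝ) • (x + y) - y) := by module
        rw [e, norm_smul, Real.norm_of_nonneg zero_le_two]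
        linarith [norm_sub_le ((1 / 2 : ℝ) • (x + y)) y]
    have hθ : |magneticPhase A x y| ≤ Real.pi / 2 := by
      calc |magneticPhase A x y| ≤ ‖x - y‖ * ‖A ((1 / 2 : ℝ) • (x + y))‖ :=
            abs_real_inner_le_norm _ _
        _ ≤ 4 * r * (Real.pi / (8 * r)) := by gcongr
        _ = Real.pi / 2 := by field_simp; norm_num
    exact Real.cos_nonneg_of_mem_Icc (abs_le.1 hθ)
  · rw [magneticPhase, hsupp hz, inner_zero_right, Real.cos_zero]
    exact zero_le_one

theorem re_magneticQuotient_mul {n : ℕ} {s : ℝ} {θ : Rn n × Rn n → ℝ} {u v : Rn n → ℝ}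
    {p : Rn n × Rn n} {c : ℝ} :
    ((c : ℂ) * (magneticQuotient s θ u p * magneticQuotient s (fun p => -θ p) v p)).re =
      c * (u p.1 * v p.1 + u p.2 * v p.2 - Real.cos (θ p) * (u p.1 * v p.2 + u p.2 * v p.1)) /
        (‖p.1 - p.2‖ ^ (((n : ℝ) + 2 * s) / 2)) ^ 2 := by
  have h1 : Complex.exp (Complex.I * (θ p : ℂ)) = Real.cos (θ p) + Real.sin (θ p) * Complex.I := by
    rw [mul_comm, Complex.exp_mul_I, Complex.ofReal_cos, Complex.ofReal_sin]
  have h2 : Complex.exp (Complex.I * ((-θ p : ℝ) : ℂ)) =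
      Real.cos (θ p) - Real.sin (θ p) * Complex.I := by
    rw [mul_comm, Complex.exp_mul_I, ← Complex.ofReal_cos, ← Complex.ofReal_sin, Real.cos_neg,
      Real.sin_neg, Complex.ofReal_neg]
    ring
  have hcs := Real.sin_sq_add_cos_sq (θ p)
  simp only [magneticQuotient, h1, h2]
  generalize ‖p.1 - p.2‖ ^ (((n : ℝ) + 2 * s) / 2) = d
  generalize Real.cos (θ p) = a at *
  generalize Real.sin (θ p) = b at *
  rw [div_mul_div_comm, ← Complex.ofReal_mul, ← mul_div_assoc, Complex.div_ofReal_re, ← sq d]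
  congr 1
  simp only [Complex.mul_re, Complex.mul_im, Complex.sub_re, Complex.sub_im, Complex.add_re,
    Complex.add_im, Complex.ofReal_re, Complex.ofReal_im, Complex.I_re, Complex.I_im]
  ring_nf
  linear_combination (c * u p.2 * v p.2) * hcs

theorem fracConst_nonneg {n : ℕ} {s : ℝ} (hs0 : 0 < s) : 0 ≤ fracConst n s := by
  have : 0 ≤ Real.Gamma ((n : ℝ) / 2 + s) := (Real.Gamma_pos_of_pos (by positivity)).le
  have := Real.pi_pos
  unfold fracConst
  positivity

/-- The magnetic form of `u` against its negative part is nonpositive. -/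
theorem magneticForm_negPart_nonpos {n : ℕ} (hn : n ≠ 0) {s : ℝ} (hs0 : 0 < s) (hs1 : s < 1)
    {A : Rn n → Rn n} (hA : AEStronglyMeasurable A volume) {M : ℝ} (hM : 0 ≤ M)
    (hθM : ∀ᵐ p : Rn n × Rn n, |magneticPhase A p.1 p.2| ≤ M * ‖p.1 - p.2‖)
    {Ω : Set (Rn n)}
    (hcos : ∀ᵐ p : Rn n × Rn n, p.1 ∈ Ω ∨ p.2 ∈ Ω → 0 ≤ Real.cos (magneticPhase A p.1 p.2))
    {u w : Rn n → ℝ} (hu : u ∈ sobolevSpace n s) (hw : w ∈ sobolevSpace n s)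
    (hwu : ∀ᵐ x, w x = max (-u x) 0) (hwΩ : ∀ x, x ∉ Ω → w x = 0) :
    magneticForm s A u w ≤ 0 := by
  have hint := integrable_magneticForm hn hs0 hs1 hM hA hθM hu hw
  rw [magneticForm_eq hs0]
  have hre := Complex.reCLM.integral_comp_comm hint
  simp only [Complex.reCLM_apply] at hre
  rw [← hre]
  refine integral_nonpos_of_ae ?_
  have h1 : ∀ᵐ p : Rn n × Rn n, w p.1 = max (-u p.1) 0 :=
    Measure.quasiMeasurePreserving_fst.ae hwu
  have h2 : ∀ᵐ p : Rn n × Rn n, w p.2 = max (-u p.2) 0 :=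
    Measure.quasiMeasurePreserving_snd.ae hwu
  filter_upwards [h1, h2, hcos] with p hp1 hp2 hc
  rw [re_magneticQuotient_mul]
  refine div_nonpos_of_nonpos_of_nonneg (mul_nonpos_of_nonneg_of_nonpos
    (fracConst_nonneg hs0) ?_) (sq_nonneg _)
  have a0 : 0 ≤ w p.1 := hp1 ▸ le_max_right _ _
  have b0 : 0 ≤ w p.2 := hp2 ▸ le_max_right _ _
  have a1 : -w p.1 ≤ u p.1 := by rw [hp1]; linarith [le_max_left (-u p.1) 0]
  have b1 : -w p.2 ≤ u p.2 := by rw [hp2]; linarith [le_max_left (-u p.2) 0]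
  have hmul : ∀ t : ℝ, t * max (-t) 0 = -(max (-t) 0) ^ 2 := by
    intro t
    rcases le_total (-t) 0 with h | h
    · simp [max_eq_right h]
    · simp only [max_eq_left h]; ring
  have a2 : u p.1 * w p.1 = -(w p.1) ^ 2 := by rw [hp1]; exact hmul _
  have b2 : u p.2 * w p.2 = -(w p.2) ^ 2 := by rw [hp2]; exact hmul _
  by_cases hΩ : p.1 ∈ Ω ∨ p.2 ∈ Ω
  · have hc0 := hc hΩ
    have hc1 := Real.cos_le_one (magneticPhase A p.1 p.2)
    -- Multiplied by `cos θ ∈ [0, 1]`, this bounds the bracket by `-(w(x) - w(y))²`.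
    have e : -(2 * (w p.1 * w p.2)) ≤ u p.1 * w p.2 + u p.2 * w p.1 := by
      nlinarith [mul_le_mul_of_nonneg_right a1 b0, mul_le_mul_of_nonneg_right b1 a0]
    have e2 := mul_le_mul_of_nonneg_left e hc0
    have e3 := mul_le_mul_of_nonneg_right hc1 (mul_nonneg a0 b0)
    rw [a2, b2]
    nlinarith [sq_nonneg (w p.1 - w p.2)]
  · rw [not_or] at hΩ
    simp [hwΩ _ hΩ.1, hwΩ _ hΩ.2]

/-! ### Passage to the limit and conclusion. -/

theorem nonneg_of_isLimitOfNonnegTests {n : ℕ} {s : ℝ} {Ω : Set (Rn n)}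
    {J : (Rn n → ℝ) → ℝ} {C : ℝ≥0∞} (hC : C < ⊤)
    (hbound : ∀ v ∈ sobolevSpace n s, ‖J v‖ₑ ≤ C * hsSize s v)
    (hsub : ∀ v ∈ sobolevSpace n s, ∀ w ∈ sobolevSpace n s, J (v - w) = J v - J w)
    (htest : ∀ φ : testSpace n s Ω, (∀ x, 0 ≤ testFun φ x) → 0 ≤ J (testFun φ))
    {w : Rn n → ℝ} (hw : w ∈ sobolevSpace n s) (hlim : IsLimitOfNonnegTests s Ω w) :
    0 ≤ J w := by
  by_contra! hneg
  -- An approximation error with `ε C < -J w` is too small for `J` to climb from `J w` to a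
  -- nonnegative value.
  obtain ⟨ε, hε, hεC⟩ := ENNReal.exists_nnreal_pos_mul_lt hC.ne
    (ENNReal.ofReal_pos.2 (neg_pos.2 hneg)).ne'
  obtain ⟨φ, h0, h1⟩ := hlim ε (by exact_mod_cast hε)
  have h2 := hbound _ (sub_mem (testFun_mem φ) hw)
  rw [hsub _ (testFun_mem φ) _ hw] at h2
  have h3 : ENNReal.ofReal (-J w) ≤ ‖J (testFun φ) - J w‖ₑ := by
    rw [Real.enorm_eq_ofReal_abs]
    refine ENNReal.ofReal_le_ofReal (le_trans ?_ (le_abs_self _))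
    linarith [htest φ h0]
  refine absurd (h3.trans (h2.trans ?_)) (not_le.2 hεC)
  rw [mul_comm]
  gcongr

theorem sobolevSpace_negPart {n : ℕ} {s : ℝ} {u w : Rn n → ℝ} (hu : u ∈ sobolevSpace n s)
    (hwm : AEStronglyMeasurable w volume) (hwu : ∀ᵐ x, w x = max (-u x) 0) :
    w ∈ sobolevSpace n s := by
  have habs : ∀ a b : ℝ, |max (-a) 0 - max (-b) 0| ≤ |a - b| := fun a b =>
    (abs_max_sub_max_le_abs (-a) (-b) 0).trans (by rw [neg_sub_neg, abs_sub_comm])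
  refine ⟨hu.1.of_le hwm ?_, hu.2.of_le (aestronglyMeasurable_gagliardoQuotient hwm) ?_⟩
  · filter_upwards [hwu] with x hx
    have := habs (u x) 0
    rw [hx]
    simpa using this
  · filter_upwards [gagliardoQuotient_congr_ae (s := s) hwu] with p hp
    rw [hp]
    simp only [gagliardoQuotient, norm_div, Real.norm_eq_abs]
    exact div_le_div_of_nonneg_right (habs _ _) (abs_nonneg _)

theorem integrable_potential {n : ℕ} {Ω : Set (Rn n)} {q u v : Rn n → ℝ}
    (hq : MemLp q ∞ (volume.restrict Ω)) (hu : MemLp u 2 volume) (hv : MemLp v 2 volume) :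
    Integrable (fun x => q x * u x * v x) (volume.restrict Ω) :=
  MemLp.integrable_mul (p := 2) (q := 2) (hu.restrict Ω |>.mul hq) (hv.restrict Ω)

theorem exists_potential_le {n : ℕ} (s : ℝ) {Ω : Set (Rn n)} {q u : Rn n → ℝ}
    (hq : MemLp q ∞ (volume.restrict Ω)) (hu : MemLp u 2 volume) :
    ∃ C : ℝ≥0∞, C < ⊤ ∧ ∀ v ∈ sobolevSpace n s,
      ‖∫ x in Ω, q x * u x * v x‖ₑ ≤ C * hsSize s v := by
  have hqu : MemLp (q * u) 2 (volume.restrict Ω) := (hu.restrict Ω).mul hq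
  refine ⟨eLpNorm (q * u) 2 (volume.restrict Ω), hqu.2, fun v hv => ?_⟩
  refine (enorm_integral_le_lintegral_enorm _).trans ?_
  have hmul := eLpNorm_smul_le_mul_eLpNorm (p := 2) (q := 2) (r := 1)
    (hv.1.restrict Ω).1 hqu.1
  rw [eLpNorm_one_eq_lintegral_enorm] at hmul
  refine hmul.trans ?_
  gcongr
  exact (eLpNorm_restrict_le v 2 volume Ω).trans le_self_add

theorem proposition3p5
    (n : ℕ) (hn : 2 ≤ n) (s : ℝ) (hs0 : 0 < s) (hs1 : s < 1)
    (Ω : Set (Rn n)) (hΩ : IsBoundedC11Domain Ω)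
    (A : Rn n → Rn n) (hA : MemLp A ∞ volume)
    (r : ℝ) (hr : 0 < r) (hsupp : Ω ∪ essSupport A ⊆ ball 0 r)
    (hsmall : ∀ i : Fin n, ∀ᵐ x, |A x i| ≤ Real.pi / (8 * √(n : ℝ) * r))
    (q : Rn n → ℝ) (hq : MemLp q ∞ (volume.restrict Ω))
    (c : ℝ) (hc : 0 < c) (hcq : ∀ᵐ x ∂(volume.restrict Ω), c ≤ q x)
    (f : Module.Dual ℝ (testSpace n s Ω)) (hf : MemHNegOn f) (hf0 : IsNonnegDistribution f)
    (g : Rn n → ℝ) (hg : MemLp g ∞ (volume.restrict (exteriorSet Ω)))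
    (hg0 : ∀ᵐ x ∂(volume.restrict (exteriorSet Ω)), 0 ≤ g x)
    (u : Rn n → ℝ) (hu : u ∈ sobolevSpace n s)
    (heq : SolvesIn A q u f)
    (hext : ∀ᵐ x ∂(volume.restrict (exteriorSet Ω)), u x = g x) :
    ∀ᵐ x, 0 ≤ u x := by
  have hn0 : n ≠ 0 := by omega
  have hAm := hA.1
  have hAbound : ∀ᵐ x, ‖A x‖ ≤ Real.pi / (8 * r) := by
    filter_upwards [ae_all_iff.2 hsmall] with x hx
    exact norm_le_of_abs_le_div hn0 hr Real.pi_pos.le hx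
  have hAmid := (quasiMeasurePreserving_midpoint n).ae hAbound
  have hM : 0 ≤ Real.pi / (8 * r) := by positivity
  have hθM : ∀ᵐ p : Rn n × Rn n,
      |magneticPhase A p.1 p.2| ≤ Real.pi / (8 * r) * ‖p.1 - p.2‖ := by
    filter_upwards [hAmid] with p hp
    rw [mul_comm]
    exact (abs_real_inner_le_norm _ _).trans (by gcongr)
  have hcos : ∀ᵐ p : Rn n × Rn n,
      p.1 ∈ Ω ∨ p.2 ∈ Ω → 0 ≤ Real.cos (magneticPhase A p.1 p.2) := by
    filter_upwards [hAmid, (quasiMeasurePreserving_midpoint n).ae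
      (ae_eq_zero_of_notMem_essSupport A)] with p hp1 hp2 hp
    exact cos_magneticPhase_nonneg hr hp1 (fun h => hp2 fun h' => h (hsupp (.inr h')))
      (hp.imp (fun h => hsupp (.inl h)) (fun h => hsupp (.inl h)))
  -- The exterior data control `u` off the closure only; the boundary is null.
  have hout : ∀ᵐ x, x ∉ Ω → 0 ≤ u x := by
    have hext' : MeasurableSet (exteriorSet Ω) := isClosed_closure.measurableSet.compl
    rw [ae_restrict_iff' hext'] at hext hg0
    filter_upwards [hext, hg0, measure_eq_zero_iff_ae_notMem.1 (volume_frontier_eq_zero hΩ)]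
      with x h1 h2 h3 hx
    have hxe : x ∈ exteriorSet Ω := by
      intro hcl
      exact h3 ⟨hcl, by rwa [hΩ.isOpen.interior_eq]⟩
    rw [h1 hxe]; exact h2 hxe
  -- A Borel representative of the negative part, zero everywhere off `Ω`: the approximation result
  -- needs pointwise vanishing, not merely almost everywhere.
  set w : Rn n → ℝ := Ω.indicator fun x => max (-hu.1.1.mk u x) 0 with hwdef
  have hwm : Measurable w :=
    ((hu.1.1.stronglyMeasurable_mk.measurable.neg).max measurable_const).indicator
      hΩ.isOpen.measurableSet
  have hw0 : ∀ x, 0 ≤ w x := fun x => indicator_nonneg (fun y _ => le_max_right _ _) x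
  have hwΩ : ∀ x, x ∉ Ω → w x = 0 := fun x hx => indicator_of_notMem hx _
  have hwu : ∀ᵐ x, w x = max (-u x) 0 := by
    filter_upwards [hu.1.1.ae_eq_mk, hout] with x h1 h2
    by_cases hx : x ∈ Ω
    · rw [hwdef, indicator_of_mem hx, ← h1]
    · rw [hwΩ x hx, max_eq_right (by linarith [h2 hx])]
  have hw : w ∈ sobolevSpace n s := sobolevSpace_negPart hu hwm.aestronglyMeasurable hwu
  obtain ⟨C₁, hC₁, hb₁⟩ := exists_magneticForm_le hn0 hs0 hs1 hM hAm hθM hu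
  obtain ⟨C₂, hC₂, hb₂⟩ := exists_potential_le s hq hu.1
  have hJ : 0 ≤ magneticForm s A u w + ∫ x in Ω, q x * u x * w x := by
    refine nonneg_of_isLimitOfNonnegTests
      (J := fun v => magneticForm s A u v + ∫ x in Ω, q x * u x * v x)
      (ENNReal.add_lt_top.2 ⟨hC₁, hC₂⟩) (fun v hv => ?_) (fun v hv v' hv' => ?_)
      (fun φ hφ => ?_) hw
      (isLimitOfNonnegTests_of_eq_zero_compl hn0 hs0 hs1 hΩ hw hwm hw0 hwΩ)
    · rw [add_mul]
      exact (enorm_add_le _ _).trans (add_le_add (hb₁ v hv) (hb₂ v hv))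
    · simp only [Pi.sub_apply, mul_sub]
      rw [magneticForm_sub hn0 hs0 hs1 hM hAm hθM hu hv hv',
        integral_sub (integrable_potential hq hu.1 hv.1) (integrable_potential hq hu.1 hv'.1)]
      ring
    · rw [heq φ]
      exact hf0 φ hφ
  have hform := magneticForm_negPart_nonpos hn0 hs0 hs1 hAm hM hθM hcos hu hw hwu hwΩ
  have hwsq : Integrable (fun x => w x ^ 2) (volume.restrict Ω) := hw.1.integrable_sq.restrict
  have hpot : ∫ x in Ω, q x * u x * w x ≤ ∫ x in Ω, -c * w x ^ 2 := by
    refine integral_mono_ae (integrable_potential hq hu.1 hw.1) (hwsq.const_mul _) ?_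
    filter_upwards [hcq, ae_restrict_of_ae hwu] with x h1 h2
    have h3 : u x * w x = -(w x) ^ 2 := by
      rw [h2]
      rcases le_total (-u x) 0 with h | h
      · simp [max_eq_right h]
      · simp only [max_eq_left h]; ring
    rw [mul_assoc, h3]
    nlinarith [mul_le_mul_of_nonneg_right h1 (sq_nonneg (w x))]
  rw [integral_const_mul] at hpot
  -- Together, `hJ`, `hform` and `hpot` give `c ∫ w² ≤ 0` with `c > 0`.
  have hzero : ∫ x in Ω, w x ^ 2 = 0 :=
    le_antisymm (by nlinarith) (integral_nonneg fun x => sq_nonneg _)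
  rw [integral_eq_zero_iff_of_nonneg (fun x => sq_nonneg _) hwsq, Filter.EventuallyEq,
    ae_restrict_iff' hΩ.isOpen.measurableSet] at hzero
  filter_upwards [hzero, hwu, hout] with x h1 h2 h3
  by_cases hx : x ∈ Ω
  · have h4 : w x = 0 := by simpa using h1 hx
    rw [h4] at h2
    linarith [le_max_left (-u x) 0]
  · exact h3 hx
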